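/- All graphs are simple. A path or cycle in a graph is called induced if the subgraph formed by its vertices and edges is an induced subgraph. An induced path $P$ in a graph $G$ \emph{closes to an induced cycle} if $G$ has an induced cycle $C$ (of length at least $3$) such that $P$ is an induced subgraph of $C$. For $n\ge 3$ let $K_n^{\diamond}$ be the graph obtained from the complete graph $K_n$ by replacing every edge with a $4$-cycle: its vertices are $v_1,\dots,v_n$ together with a vertex $v_{ij}$ for every ordered pair of distinct $i,j\in\{1,\dots,n\}$, and its edges are $\{v_i,v_{ij}\}$ and $\{v_{ij},v_j\}$ for all such ordered pairs $(i,j)$. Let $L(K_n^{\diamond})$ be its line graph. \textbf{Theorem (Induced PtoC for VT graphs).} (1) Let $G$ be a finite connected vertex-transitive graph with $|V(G)|\ge 3$. Then every induced path of length (number of edges) at most $2$ in $G$ closes to an induced cycle. (2) For every integer $\ell\ge 3$ there exist infinitely many pairwise non-isomorphic finite connected vertex-transitive graphs, each containing an induced path of length $\ell$ that does not close to an induced cycle. More precisely, the graphs $L(K_n^{\diamond})$ with $n\ge 3$ are pairwise non-isomorphic, and for every $\ell\ge 3$ there are infinitely many $n\ge 3$ such that $L(K_n^{\diamond})$ is a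 finite connected vertex-transitive graph containing an induced path of length $\ell$ that does not close to an induced cycle. -/

import Mathlib

namespace SimpleGraph

/-- A graph is vertex-transitive if its automorphism group acts transitively on its vertices. -/
def IsVertexTransitive {V : Type*} (G : SimpleGraph V) : Prop :=
  ∀ x y : V, ∃ φ : G ≃g G, φ x = y

/-- The subgraph `H` of `G` is an induced subgraph of the subgraph `K` of `G`: it is contained
in `K`, and every edge of `K` between two vertices of `H` is an edge of `H`. -/
def Subgraph.IsInducedIn {V : Type*} {G : SimpleGraph V} (H K : G.Subgraph) : Prop :=
  H ≤ K ∧ ∀ x ∈ H.verts, ∀ y ∈ H.verts, K.Adj x y → H.Adj x y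

/-- A walk is an induced path if it is a path whose vertices and edges form an induced
subgraph of `G`. -/
def Walk.IsInducedPath {V : Type*} {G : SimpleGraph V} {u v : V} (p : G.Walk u v) : Prop :=
  p.IsPath ∧ p.toSubgraph.IsInduced

/-- A closed walk is an induced cycle if it is a cycle whose vertices and edges form an induced
subgraph of `G`. -/
def Walk.IsInducedCycle {V : Type*} {G : SimpleGraph V} {w : V} (c : G.Walk w w) : Prop :=
  c.IsCycle ∧ c.toSubgraph.IsInduced

/-- `p` closes to an induced cycle: some induced cycle of `G` contains `p` as an induced
subgraph. -/
def Walk.ClosesToInducedCycle {V : Type*} {G : SimpleGraph V} {u v : V} (p : G.Walk u v) :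
    Prop :=
  ∃ (w : V) (c : G.Walk w w), c.IsInducedCycle ∧ p.toSubgraph.IsInducedIn c.toSubgraph

/-- The graph obtained from the complete graph on `Fin n` by replacing every edge with a
4-cycle. Its vertices are the `v i` (written `Sum.inl i`) and, for every ordered pair `i ≠ j`,
a vertex `v i j` (written `Sum.inr ⟨(i, j), _⟩`); the vertex `v i j` is adjacent to exactly `v i`
and `v j`. So the edge `{i, j}` becomes the 4-cycle `v i, v i j, v j, v j i`. -/
def diamondCompleteGraph (n : ℕ) :
    SimpleGraph (Fin n ⊕ {p : Fin n × Fin n // p.1 ≠ p.2}) where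
  Adj
    | Sum.inl i, Sum.inr p => i = p.1.1 ∨ i = p.1.2
    | Sum.inr p, Sum.inl i => i = p.1.1 ∨ i = p.1.2
    | _, _ => False
  symm := ⟨by rintro (i | p) (j | q) h <;> exact h⟩
  loopless := ⟨by rintro (i | p) h <;> exact h⟩

end SimpleGraph

namespace SimpleGraph

/-! ### Induced paths and cycles as walks -/

section Walks

variable {V : Type*} {G : SimpleGraph V}

/-! Part (1) reduces to induced paths `a b c`, since degrees are at least 2. If `a` and `c` are
adjacent they form a triangle with `b`. Otherwise it suffices that one component of `G - N[b]` is
adjacent to both `a` and `c`: a shortest path from `a` to `c` in the graph induced on `{a, c}` and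
the non-neighbours of `b` then closes through `b`.

Such a component comes from an extremal argument. Call a component of `G - N[b]` partial if it
misses a neighbour of `b`, and let `D` be a smallest one. For `x ∈ D`, every partial component of `G
- N[x]` avoiding `b` is a partial component of `G - N[b]` other than `D`, and the neighbours of `b`
attached to it are all adjacent to `x` (`mem_partialComps_of_mem_smallest`). By transitivity `b` and
`x` have equally many partial components, so all those of `b` other than `D` arise this way. Hence
`D` is attached to every neighbour of `b` that sees a partial component. If no component were
attached to both `a` and `c`, each would see a partial one, so `D` would be attached to both.

For part (2), vertices of the line graph are labelled by an ordered pair and a bit. The path starts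
with the edges `v₀v₁₀`, `v₀v₀₁`, `v₁v₀₁`, `v₁v₁₂`. Every neighbour of the first vertex is the
second, or is adjacent to the second or third, so no induced cycle can leave the first vertex along
another edge. The cardinality `2n(n-1)` separates the graphs. -/

theorem Walk.isInducedPath_of_getVert {u v : V} (p : G.Walk u v)
    (hinj : ∀ i j, i ≤ p.length → j ≤ p.length → p.getVert i = p.getVert j → i = j)
    (hadj : ∀ i j, i < j → j ≤ p.length → G.Adj (p.getVert i) (p.getVert j) → j = i + 1) :
    p.IsInducedPath := by
  refine ⟨(Walk.IsPath.getVert_injOn_iff p).1 fun i hi j hj h => hinj i j hi hj h, ?_⟩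
  intro x hx y hy hxy
  rw [Walk.mem_verts_toSubgraph, Walk.mem_support_iff_exists_getVert] at hx hy
  obtain ⟨i, rfl, hi⟩ := hx
  obtain ⟨j, rfl, hj⟩ := hy
  rcases lt_trichotomy i j with h | rfl | h
  · obtain rfl := hadj i j h hj hxy
    exact p.toSubgraph_adj_getVert (by omega)
  · exact absurd rfl hxy.ne
  · obtain rfl := hadj j i h hi hxy.symm
    exact (p.toSubgraph_adj_getVert (by omega)).symm

theorem exists_walk_getVert (f : ℕ → V) (n : ℕ) (h : ∀ i < n, G.Adj (f i) (f (i + 1))) :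
    ∃ p : G.Walk (f 0) (f n), p.length = n ∧ ∀ i ≤ n, p.getVert i = f i := by
  induction n generalizing f with
  | zero => exact ⟨.nil, rfl, fun i hi => by obtain rfl : i = 0 := by omega
                                             simp⟩
  | succ n ih =>
    obtain ⟨p, hp, hv⟩ := ih (fun i => f (i + 1)) fun i hi => h (i + 1) (by omega)
    refine ⟨.cons (h 0 (by omega)) p, by simp [hp], fun i hi => ?_⟩
    cases i with
    | zero => simp
    | succ i => simpa using hv i (by omega)

theorem exists_inducedPath_of_seq (f : ℕ → V) (n : ℕ)
    (hinj : ∀ i j, i ≤ n → j ≤ n → f i = f j → i = j)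
    (hadj : ∀ i j, i < j → j ≤ n → (G.Adj (f i) (f j) ↔ j = i + 1)) :
    ∃ p : G.Walk (f 0) (f n), p.IsInducedPath ∧ p.length = n ∧ ∀ i ≤ n, f i ∈ p.support := by
  obtain ⟨p, hp, hv⟩ := exists_walk_getVert (G := G) f n fun i hi =>
    (hadj i (i + 1) (by omega) (by omega)).2 rfl
  refine ⟨p, p.isInducedPath_of_getVert ?_ ?_, hp, fun i hi => hv i hi ▸ p.getVert_mem_support i⟩
  · intro i j hi hj
    rw [hv i (by omega), hv j (by omega)]
    exact hinj i j (by omega) (by omega)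
  · intro i j hij hj
    rw [hv i (by omega), hv j (by omega)]
    exact (hadj i j hij (by omega)).1

theorem Walk.isInducedPath_of_length_eq_dist {u v : V} (p : G.Walk u v)
    (hp : p.length = G.dist u v) : p.IsInducedPath := by
  refine p.isInducedPath_of_getVert ?_ ?_
  · exact fun i j hi hj h =>
      (Walk.IsPath.getVert_injOn_iff p).2 (p.isPath_of_length_eq_dist hp) hi hj h
  · intro i j hij hj h
    have := G.dist_le ((p.take i).append (.cons h (p.drop j)))
    simp only [Walk.length_append, Walk.length_cons, Walk.take_length, Walk.drop_length] at this
    omega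

theorem Walk.closesToInducedCycle_of_support_subset {u v w : V} {p : G.Walk u v}
    (hp : p.IsInducedPath) {c : G.Walk w w} (hc : c.IsInducedCycle)
    (h : ∀ x ∈ p.support, x ∈ c.support) : p.ClosesToInducedCycle := by
  have hv : ∀ x ∈ p.toSubgraph.verts, x ∈ c.toSubgraph.verts := fun x hx => by
    rw [Walk.mem_verts_toSubgraph] at hx ⊢
    exact h x hx
  exact ⟨w, c, hc, ⟨hv, fun x y hxy => hc.2 (hv _ hxy.fst_mem) (hv _ hxy.snd_mem) hxy.adj_sub⟩,
    fun x hx y hy hxy => hp.2 hx hy hxy.adj_sub⟩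

/-- The edges of `G` with both ends in `S`, as a graph on all vertices. -/
def within (G : SimpleGraph V) (S : Set V) : SimpleGraph V where
  Adj x y := G.Adj x y ∧ x ∈ S ∧ y ∈ S
  symm := ⟨fun _ _ h => ⟨h.1.symm, h.2.2, h.2.1⟩⟩
  loopless := ⟨fun _ h => h.1.ne rfl⟩

theorem within_le (S : Set V) : G.within S ≤ G := fun _ _ h => h.1

theorem within_mono {S T : Set V} (h : S ⊆ T) : G.within S ≤ G.within T :=
  fun _ _ hxy => ⟨hxy.1, h hxy.2.1, h hxy.2.2⟩

theorem mem_of_within_walk {S : Set V} {u v : V} (p : (G.within S).Walk u v) (hu : u ∈ S) :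
    ∀ x ∈ p.support, x ∈ S := by
  induction p with
  | nil => intro x hx; simp at hx; exact hx ▸ hu
  | cons h p ih =>
    intro x hx
    rw [Walk.support_cons, List.mem_cons] at hx
    rcases hx with rfl | hx
    · exact hu
    · exact ih h.2.2 x hx

/-- A shortest path from `a` to `c` inside `S` is induced, and its interior avoids `b` and all
neighbours of `b`; adding `b` therefore creates no chord. -/
theorem exists_inducedCycle_of_reachable {a b c : V} {S : Set V} (hba : G.Adj b a)
    (hbc : G.Adj b c) (hac : a ≠ c) (haS : a ∈ S)
    (hS : ∀ x ∈ S, x ≠ a → x ≠ c → x ≠ b ∧ ¬ G.Adj b x) (h : (G.within S).Reachable a c) :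
    ∃ w : G.Walk b b, w.IsInducedCycle ∧ a ∈ w.support ∧ c ∈ w.support := by
  obtain ⟨q, hq⟩ := h.exists_walk_length_eq_dist
  obtain ⟨hqp, hqi⟩ := q.isInducedPath_of_length_eq_dist hq
  have hsupp := mem_of_within_walk q haS
  have hb : b ∉ q.support := fun hb => (hS b (hsupp b hb) hba.ne hbc.ne).1 rfl
  set r := q.mapLe (within_le S) with hr
  have hrs : r.support = q.support := by simp [hr, Walk.mapLe]
  have hrp : r.IsPath := (Walk.isPath_def _).2 (hrs ▸ hqp.support_nodup)
  have hra : ∀ x ∈ r.support, ∀ y ∈ r.support, G.Adj x y → r.toSubgraph.Adj x y := by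
    intro x hx y hy hxy
    rw [hrs] at hx hy
    have := hqi ((Walk.mem_verts_toSubgraph q).2 hx) ((Walk.mem_verts_toSubgraph q).2 hy)
      ⟨hxy, hsupp x hx, hsupp y hy⟩
    rw [Walk.adj_toSubgraph_iff_mem_edges] at this ⊢
    simpa [hr, Walk.mapLe] using this
  rw [← hrs] at hb hsupp
  have hN : ∀ x ∈ r.support, G.Adj b x → x = a ∨ x = c := by
    intro x hx hbx
    by_contra hne
    push Not at hne
    exact (hS x (hsupp x hx) hne.1 hne.2).2 hbx
  clear_value r
  refine ⟨.cons hba (r.concat hbc.symm), ⟨?_, ?_⟩, by simp, by simp [Walk.support_concat]⟩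
  · rw [Walk.cons_isCycle_iff]
    refine ⟨hrp.concat hb hbc.symm, ?_⟩
    rw [Walk.edges_concat, List.concat_eq_append, List.mem_append]
    rintro (h | h)
    · exact hb (r.fst_mem_support_of_mem_edges h)
    · simp only [List.mem_singleton, Sym2.eq_iff] at h
      rcases h with ⟨-, h⟩ | ⟨-, h⟩
      · exact hba.ne h.symm
      · exact hac h
  · have key : ∀ x y, (Walk.cons hba (r.concat hbc.symm)).toSubgraph.Adj x y ↔
        s(x, y) = s(b, a) ∨ r.toSubgraph.Adj x y ∨ s(x, y) = s(c, b) := by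
      intro x y
      simp only [Walk.adj_toSubgraph_iff_mem_edges, Walk.edges_cons, Walk.edges_concat,
        List.concat_eq_append, List.mem_cons, List.mem_append, List.not_mem_nil, or_false]
    have hv : ∀ x ∈ (Walk.cons hba (r.concat hbc.symm)).toSubgraph.verts,
        x = b ∨ x ∈ r.support := by
      intro x hx
      rw [Walk.mem_verts_toSubgraph, Walk.support_cons, Walk.support_concat] at hx
      simp at hx
      tauto
    intro x hx y hy hxy
    rw [key]
    rcases hv x hx with rfl | hx' <;> rcases hv y hy with rfl | hy'
    · exact absurd rfl hxy.ne
    · rcases hN y hy' hxy with rfl | rfl <;> simp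
    · rcases hN x hx' hxy.symm with rfl | rfl <;> simp
    · exact .inr (.inl (hra x hx' y hy' hxy))

theorem exists_inducedCycle_of_triangle {a b c : V} (hba : G.Adj b a) (hbc : G.Adj b c)
    (hac : G.Adj a c) : ∃ w : G.Walk b b, w.IsInducedCycle ∧ a ∈ w.support ∧ c ∈ w.support := by
  refine exists_inducedCycle_of_reachable (S := {a, c}) hba hbc hac.ne (by simp) ?_ ?_
  · rintro x (rfl | rfl) h1 h2
    · exact absurd rfl h1
    · exact absurd rfl h2
  · exact Adj.reachable ⟨hac, by simp, by simp⟩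

/-- On an induced cycle through the `pᵢ`, the second cycle-neighbour of `p₀` would be a third
neighbour of `p₁` or of `p₂` on the cycle. -/
theorem Walk.not_closesToInducedCycle {u v p₀ p₁ p₂ p₃ : V} {p : G.Walk u v}
    (h₀ : p₀ ∈ p.support) (h₁ : p₁ ∈ p.support) (h₂ : p₂ ∈ p.support) (h₃ : p₃ ∈ p.support)
    (h01 : G.Adj p₀ p₁) (h12 : G.Adj p₁ p₂) (h23 : G.Adj p₂ p₃) (h02 : ¬ G.Adj p₀ p₂)
    (h03 : ¬ G.Adj p₀ p₃) (h13 : ¬ G.Adj p₁ p₃) (n02 : p₀ ≠ p₂)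
    (h : ∀ x, G.Adj p₀ x → x = p₁ ∨ G.Adj x p₁ ∨ G.Adj x p₂) : ¬ p.ClosesToInducedCycle := by
  rintro ⟨w, c, ⟨hc, hci⟩, ⟨hle, -⟩, -⟩
  have hs : ∀ x ∈ p.support, x ∈ c.toSubgraph.verts := fun x hx =>
    hle ((Walk.mem_verts_toSubgraph p).2 hx)
  have key : ∀ x ∈ c.toSubgraph.verts, ∀ y₁ ∈ c.toSubgraph.verts, ∀ y₂ ∈ c.toSubgraph.verts,
      ∀ y₃ ∈ c.toSubgraph.verts, G.Adj x y₁ → G.Adj x y₂ → G.Adj x y₃ → y₁ ≠ y₂ → y₁ ≠ y₃ →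
      y₂ = y₃ := by
    intro x hx y₁ m₁ y₂ m₂ y₃ m₃ a₁ a₂ a₃ n₁ n₂
    obtain ⟨s, t, -, hst⟩ := Set.ncard_eq_two.1
      (hc.ncard_neighborSet_toSubgraph_eq_two ((Walk.mem_verts_toSubgraph c).1 hx))
    have e₁ : y₁ ∈ c.toSubgraph.neighborSet x := hci hx m₁ a₁
    have e₂ : y₂ ∈ c.toSubgraph.neighborSet x := hci hx m₂ a₂
    have e₃ : y₃ ∈ c.toSubgraph.neighborSet x := hci hx m₃ a₃
    simp only [hst, Set.mem_insert_iff, Set.mem_singleton_iff] at e₁ e₂ e₃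
    grind
  obtain ⟨f, hf, hf1⟩ : ∃ f, c.toSubgraph.Adj p₀ f ∧ f ≠ p₁ := by
    obtain ⟨s, t, hne, hst⟩ := Set.ncard_eq_two.1
      (hc.ncard_neighborSet_toSubgraph_eq_two ((Walk.mem_verts_toSubgraph c).1 (hs _ h₀)))
    have es : s ∈ c.toSubgraph.neighborSet p₀ := by simp [hst]
    have et : t ∈ c.toSubgraph.neighborSet p₀ := by simp [hst]
    by_cases hsp : s = p₁
    · exact ⟨t, et, fun h => hne (hsp.trans h.symm)⟩
    · exact ⟨s, es, hsp⟩
  have hfG := hf.adj_sub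
  have n2 : f ≠ p₂ := fun e => h02 (e ▸ hfG)
  have n3 : f ≠ p₃ := fun e => h03 (e ▸ hfG)
  rcases h f hfG with e | e | e
  · exact hf1 e
  · exact n02 (key p₁ (hs _ h₁) f hf.snd_mem p₀ (hs _ h₀) p₂ (hs _ h₂) e.symm h01.symm h12
      hfG.ne' n2)
  · exact h13 (by
      have := key p₂ (hs _ h₂) f hf.snd_mem p₁ (hs _ h₁) p₃ (hs _ h₃) e.symm h12.symm h23 hf1 n3
      exact absurd (this ▸ h01) h03)

end Walks

end SimpleGraph

namespace SimpleGraph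

/-! ### Components of `G - N[b]` in vertex-transitive graphs -/

section Components

variable {V : Type*} {G : SimpleGraph V}

/-- The vertices that are neither `b` nor adjacent to `b`. -/
def farSet (G : SimpleGraph V) (b : V) : Set V := {x | x ≠ b ∧ ¬ G.Adj b x}

/-- The component of `v` in `G` minus the closed neighbourhood of `b`. -/
def farComp (G : SimpleGraph V) (b v : V) : Set V := {w | (G.within (G.farSet b)).Reachable v w}

theorem mem_farSet_comm {b x : V} : x ∈ G.farSet b ↔ b ∈ G.farSet x := by
  simp [farSet, ne_comm, adj_comm]

theorem farComp_subset {b v : V} (hv : v ∈ G.farSet b) : G.farComp b v ⊆ G.farSet b := by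
  rintro w ⟨p⟩
  exact mem_of_within_walk p hv w p.end_mem_support

theorem self_mem_farComp (b v : V) : v ∈ G.farComp b v := Reachable.refl v

theorem farComp_eq_of_mem {b v w : V} (h : w ∈ G.farComp b v) : G.farComp b w = G.farComp b v :=
  Set.ext fun _ => ⟨fun hx => Reachable.trans h hx, fun hx => (Reachable.symm h).trans hx⟩

theorem mem_farComp_of_adj {b v x y : V} (hv : v ∈ G.farSet b) (hx : x ∈ G.farComp b v)
    (hy : y ∈ G.farSet b) (hxy : G.Adj x y) : y ∈ G.farComp b v :=
  Reachable.trans hx (Adj.reachable ⟨hxy, farComp_subset hv hx, hy⟩)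

theorem farComp_subset_of_subset {b x v : V} (hv : v ∈ G.farSet b)
    (h : G.farComp b v ⊆ G.farSet x) : G.farComp b v ⊆ G.farComp x v := by
  rintro w ⟨p⟩
  have hs : ∀ y ∈ p.support, y ∈ G.farSet x := by
    classical
    exact fun y hy => h ⟨p.takeUntil y hy⟩
  clear h
  induction p with
  | nil => exact Reachable.refl _
  | cons e p ih =>
    have h1 : (G.within (G.farSet x)).Adj _ _ :=
      ⟨e.1, hs _ (by simp), hs _ (by simp)⟩
    exact h1.reachable.trans (ih e.2.2 fun y hy => hs y (by simp [hy]))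

/-- The components of `G` minus the closed neighbourhood of `b` that miss some neighbour of `b`. -/
def partialComps (G : SimpleGraph V) (b : V) : Set (Set V) :=
  {D | (∃ v ∈ G.farSet b, D = G.farComp b v) ∧ ∃ c, G.Adj b c ∧ ∀ d ∈ D, ¬ G.Adj c d}

theorem image_farSet (φ : G ≃g G) (b : V) : φ '' G.farSet b = G.farSet (φ b) := by
  ext x
  obtain ⟨y, rfl⟩ := φ.surjective x
  rw [φ.injective.mem_set_image]
  simp only [farSet, Set.mem_ofPred_eq, ne_eq, φ.injective.eq_iff, φ.map_adj_iff]

theorem image_farComp_subset (φ : G ≃g G) (b v : V) :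
    φ '' G.farComp b v ⊆ G.farComp (φ b) (φ v) := by
  rintro _ ⟨w, hw, rfl⟩
  refine Reachable.map (G := G.within (G.farSet b)) (G' := G.within (G.farSet (φ b)))
    ⟨φ, fun {x y} h => ⟨φ.map_adj_iff.2 h.1, ?_, ?_⟩⟩ hw
  · exact image_farSet φ b ▸ ⟨x, h.2.1, rfl⟩
  · exact image_farSet φ b ▸ ⟨y, h.2.2, rfl⟩

theorem image_farComp (φ : G ≃g G) (b v : V) : φ '' G.farComp b v = G.farComp (φ b) (φ v) := by
  refine (image_farComp_subset φ b v).antisymm fun w hw => ?_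
  have := image_farComp_subset φ.symm (φ b) (φ v) ⟨w, hw, rfl⟩
  simp only [RelIso.symm_apply_apply] at this
  exact ⟨_, this, by simp⟩

theorem image_mem_partialComps (φ : G ≃g G) {b : V} {D : Set V} (hD : D ∈ G.partialComps b) :
    φ '' D ∈ G.partialComps (φ b) := by
  obtain ⟨⟨v, hv, rfl⟩, c, hbc, hc⟩ := hD
  refine ⟨⟨φ v, image_farSet φ b ▸ ⟨v, hv, rfl⟩, image_farComp φ b v⟩, φ c,
    φ.map_adj_iff.2 hbc, ?_⟩
  rintro _ ⟨d, hd, rfl⟩ h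
  exact hc d hd (φ.map_adj_iff.1 h)

theorem ncard_partialComps_le [Finite V] (φ : G ≃g G) (b : V) :
    (G.partialComps b).ncard ≤ (G.partialComps (φ b)).ncard :=
  Set.ncard_le_ncard_of_injOn (fun D => φ '' D) (fun _ hD => image_mem_partialComps φ hD)
    (φ.injective.image_injective.injOn) (Set.toFinite _)

theorem IsVertexTransitive.ncard_partialComps_le [Finite V] (hG : G.IsVertexTransitive) (b x : V) :
    (G.partialComps b).ncard ≤ (G.partialComps x).ncard := by
  obtain ⟨φ, rfl⟩ := hG b x
  exact SimpleGraph.ncard_partialComps_le φ b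

/-- A component `E` of `G - N[x]`, where `x` lies in a smallest partial component `D` of
`G - N[b]`. If `E` is partial and does not contain `b`, it is a partial component of `G - N[b]`
other than `D`. -/
theorem mem_partialComps_of_mem_smallest [Finite V] {b x : V} {D E : Set V}
    (hD : D ∈ G.partialComps b)
    (hmin : ∀ D' ∈ G.partialComps x, D.ncard ≤ D'.ncard) (hx : x ∈ D)
    (hE : E ∈ G.partialComps x) (hbE : b ∉ E) :
    E ∈ G.partialComps b ∧ E ≠ D ∧ ∀ y, G.Adj b y → (∃ e ∈ E, G.Adj y e) → G.Adj x y := by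
  obtain ⟨⟨v, hv, rfl⟩, c, hbc, hc⟩ := hD
  have hEmin := hmin E hE
  obtain ⟨⟨w, hw, rfl⟩, -⟩ := hE
  have hxb : x ∈ G.farSet b := farComp_subset hv hx
  have hbx : b ∈ G.farSet x := mem_farSet_comm.1 hxb
  have hEx := farComp_subset hw
  have hEb : G.farComp x w ⊆ G.farSet b := by
    intro y hy
    refine ⟨fun h => hbE (h ▸ hy), fun h => hbE ?_⟩
    exact mem_farComp_of_adj hw hy hbx h.symm
  have hwb := hEb (self_mem_farComp x w)
  have hsub := farComp_subset_of_subset hw hEb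
  -- Otherwise `E` lies in `D` but omits `x`, so it is a partial component at `x` smaller than `D`.
  have hwD : w ∉ G.farComp b v := by
    intro hwD
    rw [← farComp_eq_of_mem hwD] at hEmin hx
    have := Set.ncard_lt_ncard (Set.ssubset_iff_of_subset hsub |>.2
      ⟨x, hx, fun h => (hEx h).1 rfl⟩)
    omega
  have hdisj : ∀ y ∈ G.farComp b w, y ∉ G.farComp b v := by
    intro y hy hy'
    exact hwD (farComp_eq_of_mem hy' ▸ farComp_eq_of_mem hy ▸ self_mem_farComp b w)
  -- The component of `w` at `b` differs from the one containing `x`, so it contains neither `x` nor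
  -- a neighbour of `x`.
  have hsub' : G.farComp b w ⊆ G.farComp x w := by
    refine farComp_subset_of_subset hwb fun y hy => ⟨fun h => hdisj y hy (h ▸ hx), fun h => ?_⟩
    exact hdisj y hy (mem_farComp_of_adj hv hx (farComp_subset hwb hy) h)
  have heq := hsub.antisymm hsub'
  refine ⟨⟨⟨w, hwb, heq⟩, c, hbc, ?_⟩, ?_, ?_⟩
  · intro d hd hcd
    -- The neighbour `c` missed by `D` is also missed by `E`: if attached, it would be absorbed into
    -- `E`, which contains no neighbour of `b`.
    have hcx : c ∈ G.farSet x := ⟨fun h => hxb.2 (h ▸ hbc), fun h => hc x hx h.symm⟩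
    exact (hEb (mem_farComp_of_adj hw hd hcx hcd.symm)).2 hbc
  · rintro h
    exact (hEx (h ▸ hx)).1 rfl
  · rintro y hby ⟨e, he, hye⟩
    by_contra hxy
    have hyx : y ∈ G.farSet x := ⟨fun h => hxb.2 (h ▸ hby), hxy⟩
    exact (hEb (mem_farComp_of_adj hw he hyx hye.symm)).2 hby

/-- In a finite vertex-transitive graph, some partial component is adjacent to all the
neighbours of `b` that are adjacent to a partial component. -/
theorem IsVertexTransitive.exists_partialComp [Finite V] (hG : G.IsVertexTransitive) {b : V}
    (hne : (G.partialComps b).Nonempty) :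
    ∃ D ∈ G.partialComps b, ∀ E ∈ G.partialComps b, ∀ y, G.Adj b y → (∃ e ∈ E, G.Adj y e) →
      ∃ d ∈ D, G.Adj y d := by
  obtain ⟨D, hD, hmin⟩ := Set.exists_min_image _ Set.ncard (Set.toFinite (G.partialComps b)) hne
  refine ⟨D, hD, fun E hE y hby hy => ?_⟩
  by_cases hED : E = D
  · exact hED ▸ hy
  obtain ⟨x, hx⟩ : D.Nonempty := by
    obtain ⟨⟨v, -, rfl⟩, -⟩ := hD
    exact ⟨v, self_mem_farComp b v⟩
  have hmin' : ∀ D' ∈ G.partialComps x, D.ncard ≤ D'.ncard := by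
    intro D' hD'
    obtain ⟨φ, hφ⟩ := hG x b
    have := hmin _ (hφ ▸ image_mem_partialComps φ hD')
    rwa [Set.ncard_image_of_injective _ φ.injective] at this
  have hsub : G.partialComps x \ {G.farComp x b} ⊆ G.partialComps b \ {D} := by
    rintro F ⟨hF, hFb⟩
    have hbF : b ∉ F := by
      obtain ⟨⟨v, -, rfl⟩, -⟩ := hF
      exact fun h => hFb (farComp_eq_of_mem h).symm
    obtain ⟨h1, h2, -⟩ := mem_partialComps_of_mem_smallest hD hmin' hx hF hbF
    exact ⟨h1, h2⟩
  -- Removing the component of `b` costs at most one partial component at `x`, while removing `D`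
  -- costs exactly one at `b`; the inclusion is thus an equality.
  have hcard : (G.partialComps b \ {D}).ncard ≤ (G.partialComps x \ {G.farComp x b}).ncard := by
    have h1 := hG.ncard_partialComps_le b x
    have h2 := Set.ncard_sdiff_singleton_add_one hD
    have h3 := Set.pred_ncard_le_ncard_sdiff_singleton (G.partialComps x) (G.farComp x b)
    omega
  have heq := Set.eq_of_subset_of_ncard_le hsub hcard
  have hE' : E ∈ G.partialComps x \ {G.farComp x b} := heq ▸ ⟨hE, hED⟩
  have hbE : b ∉ E := by
    obtain ⟨⟨v, hv, rfl⟩, -⟩ := hE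
    exact fun h => (farComp_subset hv h).1 rfl
  exact ⟨x, hx, ((mem_partialComps_of_mem_smallest hD hmin' hx hE'.1 hbE).2.2 y hby hy).symm⟩

theorem IsVertexTransitive.ncard_neighborSet_eq [Finite V] (hG : G.IsVertexTransitive) (x y : V) :
    (G.neighborSet x).ncard = (G.neighborSet y).ncard := by
  obtain ⟨φ, rfl⟩ := hG x y
  rw [← Nat.card_coe_set_eq, ← Nat.card_coe_set_eq]
  exact Nat.card_congr (φ.mapNeighborSet x)

theorem IsVertexTransitive.exists_adj_mem_farSet [Finite V] (hG : G.IsVertexTransitive)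
    {a b c : V} (hba : G.Adj b a) (hbc : G.Adj b c) (hac : a ≠ c) (hnac : ¬ G.Adj a c) :
    ∃ x ∈ G.farSet b, G.Adj a x := by
  by_contra! h
  -- Exchanging `b` for `a` and adding `c` gives `b` a larger degree than `a`.
  have hsub : insert c (insert a (G.neighborSet a \ {b})) ⊆ G.neighborSet b := by
    rintro x (rfl | rfl | ⟨hx, hxb⟩)
    · exact hbc
    · exact hba
    · by_contra hbx
      exact h x ⟨hxb, hbx⟩ hx
  have h1 := Set.ncard_le_ncard hsub
  have hab : b ∈ G.neighborSet a := hba.symm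
  have h2 := Set.ncard_sdiff_singleton_add_one hab
  rw [Set.ncard_insert_of_notMem, Set.ncard_insert_of_notMem, h2,
    hG.ncard_neighborSet_eq a b] at h1
  · omega
  · simp
  · simp [hac.symm, hnac]

/-- Two non-adjacent neighbours of `b` in a finite vertex-transitive graph are adjacent to a
common component of `G - N[b]`. -/
theorem IsVertexTransitive.exists_common_farComp [Finite V] (hG : G.IsVertexTransitive)
    {a b c : V} (hba : G.Adj b a) (hbc : G.Adj b c) (hac : a ≠ c) (hnac : ¬ G.Adj a c) :
    ∃ v ∈ G.farSet b, (∃ d ∈ G.farComp b v, G.Adj a d) ∧ ∃ d ∈ G.farComp b v, G.Adj c d := by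
  obtain ⟨x, hx, hax⟩ := hG.exists_adj_mem_farSet hba hbc hac hnac
  obtain ⟨y, hy, hcy⟩ := hG.exists_adj_mem_farSet hbc hba hac.symm fun h => hnac h.symm
  by_contra! hcon
  have hPx : G.farComp b x ∈ G.partialComps b :=
    ⟨⟨x, hx, rfl⟩, c, hbc, hcon x hx ⟨x, self_mem_farComp b x, hax⟩⟩
  have hPy : G.farComp b y ∈ G.partialComps b :=
    ⟨⟨y, hy, rfl⟩, a, hba, fun d hd had =>
      hcon y hy ⟨d, hd, had⟩ y (self_mem_farComp b y) hcy⟩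
  obtain ⟨D, ⟨⟨v, hv, rfl⟩, -⟩, hall⟩ := hG.exists_partialComp ⟨_, hPx⟩
  obtain ⟨d, hd, hcd⟩ := hall _ hPy c hbc ⟨y, self_mem_farComp b y, hcy⟩
  exact hcon v hv (hall _ hPx a hba ⟨x, self_mem_farComp b x, hax⟩) d hd hcd

theorem IsVertexTransitive.exists_inducedCycle [Finite V] (hG : G.IsVertexTransitive)
    {a b c : V} (hba : G.Adj b a) (hbc : G.Adj b c) (hac : a ≠ c) :
    ∃ w : G.Walk b b, w.IsInducedCycle ∧ a ∈ w.support ∧ c ∈ w.support := by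
  by_cases hadj : G.Adj a c
  · exact exists_inducedCycle_of_triangle hba hbc hadj
  obtain ⟨v, hv, ⟨d, hd, had⟩, e, he, hce⟩ := hG.exists_common_farComp hba hbc hac hadj
  refine exists_inducedCycle_of_reachable (S := {a, c} ∪ G.farSet b) hba hbc hac (by simp) ?_ ?_
  · rintro x ((rfl | rfl) | hx) h1 h2
    · exact absurd rfl h1
    · exact absurd rfl h2
    · exact hx
  · have hd' : d ∈ ({a, c} ∪ G.farSet b : Set V) := .inr (farComp_subset hv hd)
    have he' : e ∈ ({a, c} ∪ G.farSet b : Set V) := .inr (farComp_subset hv he)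
    have h1 : (G.within ({a, c} ∪ G.farSet b)).Adj a d := ⟨had, by simp, hd'⟩
    have h2 : (G.within ({a, c} ∪ G.farSet b)).Adj e c := ⟨hce.symm, he', by simp⟩
    have h3 : (G.within (G.farSet b)).Reachable d e := (Reachable.symm hd).trans he
    exact h1.reachable.trans ((h3.mono (within_mono Set.subset_union_right)).trans h2.reachable)

/-- If one vertex has degree 1 then all do, and a connected such graph is a single edge. -/
theorem IsVertexTransitive.exists_two_neighbors [Finite V] (hG : G.IsVertexTransitive)
    (hc : G.Connected) (hV : 3 ≤ Nat.card V) (u v : V) (huv : G.Adj u v) :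
    ∃ w, G.Adj u w ∧ w ≠ v := by
  by_contra! h
  have hdeg : ∀ x, (G.neighborSet x).ncard = 1 := fun x => by
    rw [hG.ncard_neighborSet_eq x u, Set.ncard_eq_one]
    exact ⟨v, Set.ext fun w => ⟨fun hw => h w hw, fun hw => by
      rw [Set.mem_singleton_iff] at hw; exact hw ▸ huv⟩⟩
  have hv : ∀ w, G.Adj v w → w = u := by
    obtain ⟨s, hs⟩ := Set.ncard_eq_one.1 (hdeg v)
    have hu : u ∈ G.neighborSet v := huv.symm
    intro w hw
    have hw : w ∈ G.neighborSet v := hw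
    rw [hs, Set.mem_singleton_iff] at hu hw
    exact hw.trans hu.symm
  have hcl : ∀ x y, G.Adj x y → x = u ∨ x = v → y = u ∨ y = v := by
    rintro x y hxy (rfl | rfl)
    · exact .inr (h y hxy)
    · exact .inl (hv y hxy)
  have hall : ∀ x, x = u ∨ x = v := by
    intro x
    obtain ⟨p⟩ := hc.preconnected u x
    have : ∀ {s t : V} (p : G.Walk s t), (s = u ∨ s = v) → (t = u ∨ t = v) := by
      intro s t p
      induction p with
      | nil => exact id
      | cons e _ ih => exact fun hs => ih (hcl _ _ e hs)
    exact this p (.inl rfl)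
  have huniv : (Set.univ : Set V) = {u, v} := by
    ext x
    simpa using hall x
  have := Set.ncard_pair huv.ne
  rw [← huniv, Set.ncard_univ] at this
  omega

theorem IsVertexTransitive.closesToInducedCycle [Finite V] (hG : G.IsVertexTransitive)
    (hc : G.Connected) (hV : 3 ≤ Nat.card V) {u v : V} (p : G.Walk u v) (hp : p.IsInducedPath)
    (hl : p.length ≤ 2) : p.ClosesToInducedCycle := by
  have hnt : Nontrivial V := (Finite.one_lt_card_iff_nontrivial (α := V)).1 (by omega)
  match p, hp, hl with
  | .nil, hp, _ =>
    obtain ⟨a, ha⟩ := hc.preconnected.exists_adj_of_nontrivial u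
    obtain ⟨w, hw, hwa⟩ := hG.exists_two_neighbors hc hV u a ha
    obtain ⟨c, hc, -, -⟩ := hG.exists_inducedCycle ha hw hwa.symm
    refine Walk.closesToInducedCycle_of_support_subset hp hc fun x hx => ?_
    obtain rfl : x = u := by simpa using hx
    simp
  | .cons (v := a) ha .nil, hp, _ =>
    obtain ⟨w, hw, hwa⟩ := hG.exists_two_neighbors hc hV u _ ha
    obtain ⟨c, hc, h1, -⟩ := hG.exists_inducedCycle ha hw hwa.symm
    refine Walk.closesToInducedCycle_of_support_subset hp hc fun x hx => ?_
    simp only [Walk.support_cons, Walk.support_nil, List.mem_cons, List.not_mem_nil,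
      or_false] at hx
    rcases hx with rfl | rfl
    · simp
    · exact h1
  | .cons (v := a) ha (.cons (w := w) hw .nil), hp, _ =>
    have hne : u ≠ w := by
      have := hp.1.support_nodup
      simp at this
      tauto
    obtain ⟨c, hc, h1, h2⟩ := hG.exists_inducedCycle ha.symm hw hne
    refine Walk.closesToInducedCycle_of_support_subset hp hc fun x hx => ?_
    simp only [Walk.support_cons, Walk.support_nil, List.mem_cons, List.not_mem_nil,
      or_false] at hx
    rcases hx with rfl | rfl | rfl
    · exact h1
    · simp
    · exact h2
  | .cons _ (.cons _ (.cons _ _)), _, hl => simp at hl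

end Components

end SimpleGraph

namespace SimpleGraph

/-! ### The line graphs of the diamond graphs -/

section Diamond

/-- Labels for the edges of the diamond graph: `((i, j), ε)` stands for the edge joining `v i` to
`v i j` if `ε` holds, and to `v j i` otherwise. -/
abbrev DiamondLabel (n : ℕ) : Type := {p : Fin n × Fin n // p.1 ≠ p.2} × Bool

variable {n : ℕ}

/-- The middle vertex on the edge with a given label. -/
def DiamondLabel.mid (x : DiamondLabel n) : {p : Fin n × Fin n // p.1 ≠ p.2} :=
  if x.2 then x.1 else ⟨x.1.1.swap, x.1.2.symm⟩

theorem DiamondLabel.mid_true (p : {p : Fin n × Fin n // p.1 ≠ p.2}) :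
    DiamondLabel.mid (p, true) = p := rfl

theorem DiamondLabel.mid_false (p : {p : Fin n × Fin n // p.1 ≠ p.2}) :
    DiamondLabel.mid (p, false) = ⟨p.1.swap, p.2.symm⟩ := rfl

theorem DiamondLabel.ext_mid {x y : DiamondLabel n} (h₁ : x.1.1.1 = y.1.1.1)
    (h₂ : x.mid = y.mid) : x = y := by
  obtain ⟨⟨⟨i, j⟩, hij⟩, a⟩ := x
  obtain ⟨⟨⟨k, l⟩, hkl⟩, b⟩ := y
  cases a <;> cases b <;>
    simp_all [DiamondLabel.mid_true, DiamondLabel.mid_false, Prod.ext_iff]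

/-- The edge with a given label. -/
def diamondEdge (x : DiamondLabel n) : (diamondCompleteGraph n).edgeSet :=
  ⟨s(Sum.inl x.1.1.1, Sum.inr x.mid), by
    obtain ⟨p, a⟩ := x
    cases a
    · exact Or.inr rfl
    · exact Or.inl rfl⟩

theorem diamondEdge_bijective : Function.Bijective (diamondEdge (n := n)) := by
  constructor
  · intro x y h
    have h := congrArg Subtype.val h
    simp only [diamondEdge, Sym2.eq_iff, Sum.inl.injEq, Sum.inr.injEq, reduceCtorEq, and_false,
      or_false] at h
    exact DiamondLabel.ext_mid h.1 h.2
  · have key : ∀ i p, (h : (diamondCompleteGraph n).Adj (Sum.inl i) (Sum.inr p)) →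
        ∃ x, (diamondEdge x).1 = s(Sum.inl i, Sum.inr p) := by
      rintro i p (h | h)
      · exact ⟨(p, true), by simp [diamondEdge, DiamondLabel.mid_true, h]⟩
      · exact ⟨(⟨p.1.swap, p.2.symm⟩, false), by
          simp [diamondEdge, DiamondLabel.mid_false, h]⟩
    rintro ⟨e, he⟩
    induction e using Sym2.ind with
    | _ u v =>
      rw [mem_edgeSet] at he
      rcases u with i | p <;> rcases v with j | q
      · exact he.elim
      · obtain ⟨x, hx⟩ := key i q he
        exact ⟨x, Subtype.ext hx⟩
      · obtain ⟨x, hx⟩ := key j p he.symm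
        exact ⟨x, Subtype.ext (hx.trans Sym2.eq_swap)⟩
      · exact he.elim

/-- The line graph of the diamond graph, on labels. -/
def diamondLabelGraph (n : ℕ) : SimpleGraph (DiamondLabel n) where
  Adj x y := x ≠ y ∧ (x.1.1.1 = y.1.1.1 ∨ x.mid = y.mid)
  symm := ⟨fun _ _ h => ⟨h.1.symm, h.2.imp Eq.symm Eq.symm⟩⟩
  loopless := ⟨fun _ h => h.1 rfl⟩

/-- The labelling is an isomorphism onto the line graph of the diamond graph. -/
noncomputable def diamondLabelIso (n : ℕ) :
    diamondLabelGraph n ≃g (diamondCompleteGraph n).lineGraph where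
  toEquiv := Equiv.ofBijective _ diamondEdge_bijective
  map_rel_iff' := by
    intro x y
    rw [lineGraph_adj_iff_exists]
    simp only [Equiv.ofBijective_apply, ne_eq, diamondEdge_bijective.1.eq_iff]
    refine and_congr_right fun _ => ?_
    simp [diamondEdge]

theorem card_diamondLabel (n : ℕ) : Nat.card (DiamondLabel n) = (n * n - n) * 2 := by
  have h : (Finset.univ.filter fun p : Fin n × Fin n => p.1 ≠ p.2) =
      (Finset.univ : Finset (Fin n)).offDiag := by
    ext p
    simp
  rw [Nat.card_eq_fintype_card, Fintype.card_prod, Fintype.card_bool, Fintype.card_subtype, h,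
    Finset.offDiag_card, Finset.card_univ, Fintype.card_fin]

theorem eq_of_iso_lineGraph_diamond {m n : ℕ} (hm : 3 ≤ m) (hn : 3 ≤ n)
    (h : Nonempty ((diamondCompleteGraph m).lineGraph ≃g (diamondCompleteGraph n).lineGraph)) :
    m = n := by
  obtain ⟨φ⟩ := h
  have hc := Nat.card_congr
    (((diamondLabelIso m).trans φ).trans (diamondLabelIso n).symm).toEquiv
  rw [card_diamondLabel, card_diamondLabel] at hc
  -- These bounds make the truncated subtractions in the cardinalities genuine.
  have hm' : m ≤ m * m := Nat.le_mul_self m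
  have hn' : n ≤ n * n := Nat.le_mul_self n
  have h2 : m * m + n = n * n + m := by omega
  rcases lt_trichotomy m n with h | h | h
  · nlinarith
  · exact h
  · nlinarith

theorem diamondLabelGraph_connected (hn : 3 ≤ n) : (diamondLabelGraph n).Connected := by
  have same : ∀ x y : DiamondLabel n, x.1.1.1 = y.1.1.1 →
      (diamondLabelGraph n).Reachable x y := by
    intro x y h
    by_cases hxy : x = y
    · exact hxy ▸ Reachable.refl x
    · exact Adj.reachable ⟨hxy, .inl h⟩
  have : Nonempty (DiamondLabel n) := ⟨⟨⟨(⟨0, by omega⟩, ⟨1, by omega⟩), by simp⟩, true⟩⟩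
  refine ⟨fun x y => ?_⟩
  by_cases h : x.1.1.1 = y.1.1.1
  · exact same x y h
  · let s : DiamondLabel n := (⟨(x.1.1.1, y.1.1.1), h⟩, true)
    let t : DiamondLabel n := (⟨(y.1.1.1, x.1.1.1), Ne.symm h⟩, false)
    have hst : (diamondLabelGraph n).Adj s t := ⟨fun e => by simp [s, t] at e, .inr rfl⟩
    exact ((same x s rfl).trans hst.reachable).trans (same t y rfl)

/-- A permutation of the indices and a possible reversal of all ordered pairs act on the labels. -/
def diamondLabelAut (σ : Equiv.Perm (Fin n)) (a : Bool) :
    diamondLabelGraph n ≃g diamondLabelGraph n where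
  toFun x := (⟨(σ x.1.1.1, σ x.1.1.2), fun h => x.1.2 (σ.injective h)⟩, x.2 ^^ a)
  invFun x := (⟨(σ.symm x.1.1.1, σ.symm x.1.1.2), fun h => x.1.2 (σ.symm.injective h)⟩, x.2 ^^ a)
  left_inv x := by simp
  right_inv x := by simp
  map_rel_iff' := by
    rintro ⟨⟨⟨i, j⟩, hij⟩, b⟩ ⟨⟨⟨k, l⟩, hkl⟩, c⟩
    cases a <;> cases b <;> cases c <;>
      simp [diamondLabelGraph, DiamondLabel.mid, and_comm]

theorem diamondLabelGraph_isVertexTransitive : (diamondLabelGraph n).IsVertexTransitive := by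
  rintro ⟨⟨⟨i, j⟩, hij⟩, b⟩ ⟨⟨⟨k, l⟩, hkl⟩, c⟩
  have hij : i ≠ j := hij
  have hkl : k ≠ l := hkl
  -- The first swap sends `i` to `k`; the second moves the image of `j` to `l` and fixes `k`.
  let σ := (Equiv.swap i k).trans (Equiv.swap (Equiv.swap i k j) l)
  have h1 : σ i = k := by
    simp only [σ, Equiv.trans_apply, Equiv.swap_apply_left]
    refine Equiv.swap_apply_of_ne_of_ne (fun h => hij ?_) hkl
    apply (Equiv.swap i k).injective
    rw [← h, Equiv.swap_apply_left]
  have h2 : σ j = l := by simp [σ]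
  refine ⟨diamondLabelAut σ (b ^^ c), ?_⟩
  change ((⟨(σ i, σ j), _⟩, b ^^ (b ^^ c)) : DiamondLabel n) = _
  simp [h1, h2]

theorem IsVertexTransitive.of_iso {V W : Type*} {G : SimpleGraph V} {H : SimpleGraph W}
    (φ : G ≃g H) (hG : G.IsVertexTransitive) : H.IsVertexTransitive := by
  intro x y
  obtain ⟨ψ, hψ⟩ := hG (φ.symm x) (φ.symm y)
  refine ⟨(φ.symm.trans ψ).trans φ, ?_⟩
  simp [hψ]

/-- After the initial edge `v₀v₁₀`, the labels trace the edges of the path `v₀, v₀₁, v₁, v₁₂, v₂,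
…`. -/
theorem exists_label_sequence {ℓ : ℕ} (hn : ℓ + 3 ≤ n) : ∃ f : ℕ → DiamondLabel n,
    ((f 0).1.1.1.val = 0 ∧ (f 0).1.1.2.val = 1 ∧ (f 0).2 = false) ∧
    (∀ k, 2 * k + 1 ≤ ℓ → (f (2 * k + 1)).1.1.1.val = k ∧ (f (2 * k + 1)).1.1.2.val = k + 1 ∧
      (f (2 * k + 1)).2 = true) ∧
    ∀ k, 2 * k + 2 ≤ ℓ → (f (2 * k + 2)).1.1.1.val = k + 1 ∧ (f (2 * k + 2)).1.1.2.val = k ∧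
      (f (2 * k + 2)).2 = false := by
  have key : ∀ m : ℕ, ∃ x : DiamondLabel n,
      (m = 0 → x.1.1.1.val = 0 ∧ x.1.1.2.val = 1 ∧ x.2 = false) ∧
      (∀ k, m = 2 * k + 1 → m ≤ ℓ → x.1.1.1.val = k ∧ x.1.1.2.val = k + 1 ∧ x.2 = true) ∧
      ∀ k, m = 2 * k + 2 → m ≤ ℓ → x.1.1.1.val = k + 1 ∧ x.1.1.2.val = k ∧ x.2 = false := by
    intro m
    by_cases hm : m ≤ ℓ ∧ m ≠ 0
    · rcases Nat.even_or_odd' (m - 1) with ⟨k, hk | hk⟩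
      · refine ⟨⟨⟨(⟨k, by omega⟩, ⟨k + 1, by omega⟩), by simp⟩, true⟩, by omega, ?_, by omega⟩
        intro j hj _
        obtain rfl : j = k := by omega
        simp
      · refine ⟨⟨⟨(⟨k + 1, by omega⟩, ⟨k, by omega⟩), by simp⟩, false⟩, by omega, by omega, ?_⟩
        intro j hj _
        obtain rfl : j = k := by omega
        simp
    -- The label of `v₀v₁₀` is the value at `0`, and a junk value beyond `ℓ`.
    · refine ⟨⟨⟨(⟨0, by omega⟩, ⟨1, by omega⟩), by simp⟩, false⟩, by simp, ?_, ?_⟩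
      · intro k h1 h2
        omega
      · intro k h1 h2
        omega
  choose f h0 h1 h2 using key
  exact ⟨f, h0 0 rfl, fun k hk => h1 _ k rfl hk, fun k hk => h2 _ k rfl hk⟩

theorem DiamondLabel.mid_eq_iff {x y : DiamondLabel n} (h : x.2 ≠ y.2) :
    x.mid = y.mid ↔ x.1.1.1 = y.1.1.2 ∧ x.1.1.2 = y.1.1.1 := by
  obtain ⟨⟨⟨i, j⟩, hij⟩, a⟩ := x
  obtain ⟨⟨⟨k, l⟩, hkl⟩, b⟩ := y
  cases a <;> cases b <;> simp_all [DiamondLabel.mid, and_comm]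

theorem DiamondLabel.mid_eq_iff_of_eq {x y : DiamondLabel n} (h : x.2 = y.2) :
    x.mid = y.mid ↔ x.1 = y.1 := by
  obtain ⟨⟨⟨i, j⟩, hij⟩, a⟩ := x
  obtain ⟨⟨⟨k, l⟩, hkl⟩, b⟩ := y
  cases a <;> cases b <;> simp_all [DiamondLabel.mid, and_comm]

theorem diamondLabelGraph_adj_iff {x y : DiamondLabel n} : (diamondLabelGraph n).Adj x y ↔
    x ≠ y ∧ (x.1.1.1.val = y.1.1.1.val ∨
      x.2 ≠ y.2 ∧ x.1.1.1.val = y.1.1.2.val ∧ x.1.1.2.val = y.1.1.1.val) := by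
  refine and_congr_right fun hxy => ?_
  simp only [← Fin.ext_iff]
  refine or_congr_right ?_
  by_cases h : x.2 = y.2
  · simp only [DiamondLabel.mid_eq_iff_of_eq h, h, ne_eq, not_true_eq_false, false_and, iff_false]
    exact fun h' => hxy (Prod.ext h' h)
  · simp [DiamondLabel.mid_eq_iff h, h]

theorem DiamondLabel.eq_iff_val {x y : DiamondLabel n} : x = y ↔
    x.1.1.1.val = y.1.1.1.val ∧ x.1.1.2.val = y.1.1.2.val ∧ x.2 = y.2 := by
  simp only [Prod.ext_iff, Subtype.ext_iff, Fin.ext_iff, and_assoc]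

theorem exists_inducedPath_not_closes {ℓ : ℕ} (hℓ : 3 ≤ ℓ) (hn : ℓ + 3 ≤ n) :
    ∃ (e f : (diamondCompleteGraph n).edgeSet) (p : (diamondCompleteGraph n).lineGraph.Walk e f),
      p.IsInducedPath ∧ p.length = ℓ ∧ ¬ p.ClosesToInducedCycle := by
  obtain ⟨f, h0, hodd, heven⟩ := exists_label_sequence (n := n) hn
  have hadj : ∀ i j, i < j → j ≤ ℓ →
      f i ≠ f j ∧ ((diamondLabelGraph n).Adj (f i) (f j) ↔ j = i + 1) := by
    intro i j hij hj
    have hform : ∀ m, m ≤ ℓ → (m = 0 ∨ (∃ k, m = 2 * k + 1) ∨ ∃ k, m = 2 * k + 2) := by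
      intro m _
      rcases Nat.even_or_odd' m with ⟨k, hk | hk⟩
      · cases k with
        | zero => exact .inl hk
        | succ k => exact .inr (.inr ⟨k, by omega⟩)
      · exact .inr (.inl ⟨k, hk⟩)
    rw [diamondLabelGraph_adj_iff, ne_eq, DiamondLabel.eq_iff_val]
    rcases hform i (by omega) with rfl | ⟨k, rfl⟩ | ⟨k, rfl⟩ <;>
      rcases hform j hj with rfl | ⟨l, rfl⟩ | ⟨l, rfl⟩
    · omega
    · obtain ⟨a1, a2, a3⟩ := h0
      obtain ⟨b1, b2, b3⟩ := hodd l hj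
      simp only [a1, a2, a3, b1, b2, b3]
      simp
      omega
    · obtain ⟨a1, a2, a3⟩ := h0
      obtain ⟨b1, b2, b3⟩ := heven l hj
      simp only [a1, a2, a3, b1, b2, b3]
      simp
    · omega
    · obtain ⟨a1, a2, a3⟩ := hodd k (by omega)
      obtain ⟨b1, b2, b3⟩ := hodd l hj
      simp only [a1, a2, a3, b1, b2, b3]
      simp
      omega
    · obtain ⟨a1, a2, a3⟩ := hodd k (by omega)
      obtain ⟨b1, b2, b3⟩ := heven l hj
      simp only [a1, a2, a3, b1, b2, b3]
      simp
      omega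
    · omega
    · obtain ⟨a1, a2, a3⟩ := heven k (by omega)
      obtain ⟨b1, b2, b3⟩ := hodd l hj
      simp only [a1, a2, a3, b1, b2, b3]
      simp
      omega
    · obtain ⟨a1, a2, a3⟩ := heven k (by omega)
      obtain ⟨b1, b2, b3⟩ := heven l hj
      simp only [a1, a2, a3, b1, b2, b3]
      simp
      omega
  let φ := diamondLabelIso n
  have hA : ∀ i j, i < j → j ≤ ℓ →
      ((diamondCompleteGraph n).lineGraph.Adj (φ (f i)) (φ (f j)) ↔ j = i + 1) :=
    fun i j hij hj => φ.map_adj_iff.trans (hadj i j hij hj).2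
  obtain ⟨p, hp, hl, hs⟩ := exists_inducedPath_of_seq (fun i => φ (f i)) ℓ (by
    intro i j hi hj h
    have h := φ.injective h
    rcases lt_trichotomy i j with hij | hij | hij
    · exact absurd h (hadj i j hij hj).1
    · exact hij
    · exact absurd h.symm (hadj j i hij hi).1) hA
  refine ⟨_, _, p, hp, hl, Walk.not_closesToInducedCycle (hs 0 (by omega)) (hs 1 (by omega))
    (hs 2 (by omega)) (hs 3 (by omega)) ((hA 0 1 (by omega) (by omega)).2 rfl)
    ((hA 1 2 (by omega) (by omega)).2 rfl) ((hA 2 3 (by omega) (by omega)).2 rfl)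
    (fun h => by simpa using (hA 0 2 (by omega) (by omega)).1 h)
    (fun h => by simpa using (hA 0 3 (by omega) (by omega)).1 h)
    (fun h => by simpa using (hA 1 3 (by omega) (by omega)).1 h)
    (fun h => (hadj 0 2 (by omega) (by omega)).1 (φ.injective h)) fun y hy => ?_⟩
  obtain ⟨x, rfl⟩ := φ.surjective y
  simp only [φ.map_adj_iff, φ.injective.eq_iff] at hy ⊢
  have h1 := hodd 0 (by omega)
  have h2 := heven 0 (by omega)
  simp only [mul_zero, zero_add] at h1 h2
  rw [diamondLabelGraph_adj_iff] at hy
  by_cases hx1 : x = f 1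
  · exact .inl hx1
  refine .inr ?_
  -- Either `x` shares `v₀` with `f 0`, hence with `f 1`, or it is `v₁v₁₀`, which shares `v₁` with
  -- `f 2`.
  rcases hy.2 with h | ⟨ha, hb, hc⟩
  · exact .inl (diamondLabelGraph_adj_iff.2 ⟨hx1, .inl (by omega)⟩)
  · refine .inr (diamondLabelGraph_adj_iff.2 ⟨fun e => ?_, .inl (by omega)⟩)
    rw [e, h0.2.2, h2.2.2] at ha
    exact ha rfl

end Diamond

end SimpleGraph

theorem mainTheorem2 :
    (∀ (V : Type*) [Finite V] (G : SimpleGraph V), G.Connected → G.IsVertexTransitive →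
      3 ≤ Nat.card V →
      ∀ (u v : V) (p : G.Walk u v), p.IsInducedPath → p.length ≤ 2 → p.ClosesToInducedCycle) ∧
    (∀ m n : ℕ, 3 ≤ m → 3 ≤ n →
      Nonempty ((SimpleGraph.diamondCompleteGraph m).lineGraph ≃g
        (SimpleGraph.diamondCompleteGraph n).lineGraph) → m = n) ∧
    (∀ ℓ : ℕ, 3 ≤ ℓ →
      {n : ℕ | 3 ≤ n ∧
        Finite (SimpleGraph.diamondCompleteGraph n).edgeSet ∧
        (SimpleGraph.diamondCompleteGraph n).lineGraph.Connected ∧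
        (SimpleGraph.diamondCompleteGraph n).lineGraph.IsVertexTransitive ∧
        ∃ (e f : (SimpleGraph.diamondCompleteGraph n).edgeSet)
          (p : (SimpleGraph.diamondCompleteGraph n).lineGraph.Walk e f),
          p.IsInducedPath ∧ p.length = ℓ ∧ ¬ p.ClosesToInducedCycle}.Infinite) := by
  refine ⟨fun V _ G hc hG hV u v p hp hl => hG.closesToInducedCycle hc hV p hp hl,
    fun m n hm hn h => SimpleGraph.eq_of_iso_lineGraph_diamond hm hn h, fun ℓ hℓ => ?_⟩
  refine (Set.Ici_infinite (ℓ + 3)).mono fun n hn => ?_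
  have hn : ℓ + 3 ≤ n := hn
  exact ⟨by omega, inferInstance,
    (SimpleGraph.diamondLabelIso n).connected_iff.1
      (SimpleGraph.diamondLabelGraph_connected (by omega)),
    SimpleGraph.diamondLabelGraph_isVertexTransitive.of_iso (SimpleGraph.diamondLabelIso n),
    SimpleGraph.exists_inducedPath_not_closes hℓ hn⟩
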